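/- Let $F=\{0,1\}$ be the two-element field and let $\langle x,y\rangle=x_1y_1\oplus\dots\oplus x_ny_n$ for $x,y\in F^n$. A function $f:F^n\to F$ is called bent if its Walsh--Hadamard transform $W_f(y)=\sum_{x\in F^n}(-1)^{f(x)\oplus\langle x,y\rangle}$ takes only the values $\pm 2^{n/2}$. Let $N_n$ be the number of bent functions $F^n\to F$. (1) There is a sequence of real numbers $\varepsilon_n\to 0$ such that, for every even $n$, $$N_n\le 6^{3\cdot 2^{n-6}}\cdot 2^{2^{n-2}(1+\varepsilon_n)} .$$ (2) There is a sequence of real numbers $\delta_n\to 0$ such that, for every even $n$, $$\log_2 N_n\le 3\cdot 2^{n-3}(1+\delta_n),$$ and for all sufficiently large $n$ the right-hand side is less than $2^{n-1}$, hence less than the exponent $\sum_{i=0}^{n/2}\binom{n}{i}=2^{n-1}+\frac12\binom{n}{n/2}$ ($n$ even) of the trivial bound that comes from counting the Boolean functions of algebraic degree at most $n/2$. (3) For every $n\ge 0$, $\;6^{3\cdot 2^{n-6}}\cdot 2^{2^{n-2}}<2^{3\cdot 2^{n-3}}$. -/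

import Mathlib

open Filter Topology

/-- Boolean functions in `n` variables, where `ZMod 2` plays the role of the two-element field. -/
abbrev BoolFun (n : ℕ) : Type := (Fin n → ZMod 2) → ZMod 2

/-- The Walsh--Hadamard transform `W_f(y) = ∑ₓ (-1)^(f(x) ⊕ ⟨x, y⟩)`. -/
def walshHadamard {n : ℕ} (f : BoolFun n) (y : Fin n → ZMod 2) : ℤ :=
  ∑ x : Fin n → ZMod 2, (-1 : ℤ) ^ (f x + x ⬝ᵥ y).val

/-- `f` is bent if its Walsh--Hadamard transform takes only the values `± 2^(n/2)`
(real exponent `n/2`, so for odd `n` no function is bent). -/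
def IsBent {n : ℕ} (f : BoolFun n) : Prop :=
  ∀ y : Fin n → ZMod 2,
    (walshHadamard f y : ℝ) = (2 : ℝ) ^ ((n : ℝ) / 2) ∨
      (walshHadamard f y : ℝ) = -(2 : ℝ) ^ ((n : ℝ) / 2)

/-- The number of bent functions in `n` variables. -/
noncomputable def numBent (n : ℕ) : ℕ := Nat.card {f : BoolFun n // IsBent f}

/-- The sign `(-1)^c` of an element of the two-element field. -/
def sgn (c : ZMod 2) : ℤ := (-1) ^ c.val

lemma sgn_zero : sgn 0 = 1 := rfl

lemma sgn_add (a b : ZMod 2) : sgn (a + b) = sgn a * sgn b := by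
  revert a b; decide

lemma sgn_mul_self (a : ZMod 2) : sgn a * sgn a = 1 := by
  revert a; decide

lemma sgn_eq_sub (a : ZMod 2) : sgn a = 1 - 2 * (a.val : ℤ) := by
  revert a; decide

lemma sgn_injective : Function.Injective sgn := by
  intro a b; revert a b; decide

lemma sgn_eq_one_or (a : ZMod 2) : sgn a = 1 ∨ sgn a = -1 := by
  revert a; decide

lemma sgn_sum {ι : Type*} (s : Finset ι) (c : ι → ZMod 2) :
    sgn (∑ i ∈ s, c i) = ∏ i ∈ s, sgn (c i) := by
  classical
  induction s using Finset.induction_on with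
  | empty => simp [sgn_zero]
  | insert a s ha ih => rw [Finset.sum_insert ha, Finset.prod_insert ha, sgn_add, ih]

lemma walshHadamard_eq {n : ℕ} (f : BoolFun n) (y : Fin n → ZMod 2) :
    walshHadamard f y = ∑ x, sgn (f x) * sgn (x ⬝ᵥ y) := by
  simp only [← sgn_add]; rfl

lemma add_self_vec {n : ℕ} (x : Fin n → ZMod 2) : x + x = 0 := by
  ext i; exact CharTwo.add_self_eq_zero _

/-- The coordinate subspace of vectors supported in `T`. -/
def coordSubspace {n : ℕ} (T : Finset (Fin n)) : Finset (Fin n → ZMod 2) :=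
  Fintype.piFinset fun i => if i ∈ T then Finset.univ else {0}

section CoordSubspace

variable {n : ℕ} {T : Finset (Fin n)}

lemma mem_coordSubspace {x : Fin n → ZMod 2} :
    x ∈ coordSubspace T ↔ ∀ i, i ∉ T → x i = 0 := by
  simp only [coordSubspace, Fintype.mem_piFinset]
  refine forall_congr' fun i => ?_
  by_cases h : i ∈ T <;> simp [h]

lemma card_coordSubspace (T : Finset (Fin n)) : (coordSubspace T).card = 2 ^ T.card := by
  rw [coordSubspace, Fintype.card_piFinset]
  have h : ∀ i, (if i ∈ T then (Finset.univ : Finset (ZMod 2)) else {0}).card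
      = if i ∈ T then 2 else 1 := by
    intro i; split_ifs <;> simp [ZMod.card]
  simp only [h]
  rw [Finset.prod_ite]
  simp

lemma zero_mem_coordSubspace : (0 : Fin n → ZMod 2) ∈ coordSubspace T :=
  mem_coordSubspace.2 fun _ _ => rfl

lemma add_mem_coordSubspace {x y : Fin n → ZMod 2} (hx : x ∈ coordSubspace T)
    (hy : y ∈ coordSubspace T) : x + y ∈ coordSubspace T :=
  mem_coordSubspace.2 fun i hi => by
    rw [Pi.add_apply, mem_coordSubspace.1 hx i hi, mem_coordSubspace.1 hy i hi, add_zero]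

lemma coordSubspace_mono {S : Finset (Fin n)} (h : S ⊆ T) :
    coordSubspace S ⊆ coordSubspace T :=
  fun _ hx => mem_coordSubspace.2 fun i hi => mem_coordSubspace.1 hx i fun hS => hi (h hS)

@[to_additive]
lemma prod_coordSubspace_add {M : Type*} [CommMonoid M] (F : (Fin n → ZMod 2) → M)
    {u : Fin n → ZMod 2} (hu : u ∈ coordSubspace T) :
    ∏ v ∈ coordSubspace T, F (v + u) = ∏ v ∈ coordSubspace T, F v := by
  have h : ∀ v : Fin n → ZMod 2, v + u + u = v := fun v => by
    rw [add_assoc, add_self_vec, add_zero]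
  exact Finset.prod_nbij' (fun v => v + u) (fun v => v + u)
    (fun v hv => add_mem_coordSubspace hv hu) (fun v hv => add_mem_coordSubspace hv hu)
    (fun v _ => h v) (fun v _ => h v) (fun _ _ => rfl)

lemma sum_univ_eq_sum_coordSubspace {M : Type*} [AddCommMonoid M] (T : Finset (Fin n))
    (F : (Fin n → ZMod 2) → M) :
    ∑ y, F y = ∑ y ∈ coordSubspace T, ∑ v ∈ coordSubspace Tᶜ, F (y + v) := by
  rw [← Finset.sum_product']
  symm
  refine Finset.sum_nbij' (fun p => p.1 + p.2)
    (fun z => (fun i => if i ∈ T then z i else 0, fun i => if i ∈ T then 0 else z i))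
    ?_ ?_ ?_ ?_ ?_
  · simp
  · intro z _
    simp only [Finset.mem_product, mem_coordSubspace]
    constructor
    · intro i hi; simp [hi]
    · intro i hi; simp at hi; simp [hi]
  · rintro ⟨y, v⟩ h
    simp only [Finset.mem_product, mem_coordSubspace] at h
    ext i
    · by_cases hi : i ∈ T
      · have := h.2 i (by simpa using hi); simp [hi, this]
      · simp [hi, h.1 i hi]
    · by_cases hi : i ∈ T
      · have := h.2 i (by simpa using hi); simp [hi, this]
      · simp [hi, h.1 i hi]
  · intro z _
    ext i
    by_cases hi : i ∈ T <;> simp [hi]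
  · simp

lemma sum_sgn_dotProduct_coordSubspace (S : Finset (Fin n)) (x : Fin n → ZMod 2) :
    ∑ v ∈ coordSubspace S, sgn (x ⬝ᵥ v) =
      if x ∈ coordSubspace Sᶜ then 2 ^ S.card else 0 := by
  have h1 : ∀ v : Fin n → ZMod 2, sgn (x ⬝ᵥ v) = ∏ i, sgn (x i * v i) := fun v => sgn_sum _ _
  simp only [h1]
  rw [show coordSubspace S = Fintype.piFinset fun i => if i ∈ S then Finset.univ else {0} from rfl,
    ← Finset.prod_univ_sum (fun i => if i ∈ S then Finset.univ else {0})
    (fun i c => sgn (x i * c))]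
  have h2 : ∀ i, ∑ c ∈ (if i ∈ S then (Finset.univ : Finset (ZMod 2)) else {0}), sgn (x i * c)
      = if i ∈ S then (if x i = 0 then 2 else 0) else 1 := by
    intro i
    by_cases hi : i ∈ S
    · simp only [hi, if_true]
      generalize x i = a
      revert a; decide
    · simp [hi, sgn_zero]
  simp only [h2]
  by_cases hx : ∀ i ∈ S, x i = 0
  · rw [if_pos (mem_coordSubspace.2 fun i hi => hx i (by simpa using hi)), Finset.prod_ite]
    rw [Finset.prod_congr rfl (g := fun _ => (2 : ℤ)) fun i hi => if_pos (hx i (by simpa using hi))]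
    simp
  · push Not at hx
    obtain ⟨i, hi, hxi⟩ := hx
    rw [if_neg fun h => hxi (mem_coordSubspace.1 h i (by simpa using hi))]
    exact Finset.prod_eq_zero (Finset.mem_univ i) (by simp [hi, hxi])

lemma coordSubspace_univ : coordSubspace (Finset.univ : Finset (Fin n)) = Finset.univ := by
  ext x; simp [mem_coordSubspace]

lemma sum_sgn_dotProduct (x : Fin n → ZMod 2) :
    ∑ v, sgn (x ⬝ᵥ v) = if x = 0 then 2 ^ n else 0 := by
  have h := sum_sgn_dotProduct_coordSubspace Finset.univ x
  rw [coordSubspace_univ] at h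
  rw [h, Finset.card_univ, Fintype.card_fin]
  refine if_congr ?_ rfl rfl
  rw [mem_coordSubspace, funext_iff]
  simp

/-- Poisson summation over a coordinate subspace. -/
lemma sum_walshHadamard_coordSubspace (f : BoolFun n) (T : Finset (Fin n))
    (y : Fin n → ZMod 2) :
    ∑ v ∈ coordSubspace Tᶜ, walshHadamard f (y + v) =
      2 ^ Tᶜ.card * ∑ x ∈ coordSubspace T, sgn (f x) * sgn (x ⬝ᵥ y) := by
  simp only [walshHadamard_eq, dotProduct_add, sgn_add]
  rw [Finset.sum_comm]
  have : ∀ x, ∑ v ∈ coordSubspace Tᶜ, sgn (f x) * (sgn (x ⬝ᵥ y) * sgn (x ⬝ᵥ v)) =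
      if x ∈ coordSubspace T then 2 ^ Tᶜ.card * (sgn (f x) * sgn (x ⬝ᵥ y)) else 0 := by
    intro x
    simp only [← mul_assoc]
    rw [← Finset.mul_sum, sum_sgn_dotProduct_coordSubspace, compl_compl]
    split_ifs <;> ring
  simp only [this]
  rw [Finset.mul_sum, ← Finset.sum_filter]
  exact Finset.sum_congr (by ext; simp) fun _ _ => rfl

end CoordSubspace

/-- `g` is the dual of the bent function `f` in `2 * k` variables. -/
def IsDual {n : ℕ} (k : ℕ) (f g : BoolFun n) : Prop :=
  ∀ y, walshHadamard f y = 2 ^ k * sgn (g y)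

section Dual

variable {n k : ℕ} {f g : BoolFun n}

lemma isBent_iff_exists_isDual (hn : n = 2 * k) :
    IsBent f ↔ ∃ g : BoolFun n, IsDual k f g := by
  have hpow : (2 : ℝ) ^ ((n : ℝ) / 2) = ((2 ^ k : ℤ) : ℝ) := by
    rw [hn]; push_cast
    rw [mul_div_cancel_left₀ _ (two_ne_zero), Real.rpow_natCast]
  constructor
  · intro h
    refine ⟨fun y => if walshHadamard f y = 2 ^ k then 0 else 1, fun y => ?_⟩
    by_cases hy : walshHadamard f y = 2 ^ k
    · simp [hy, sgn_zero]
    · have := h y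
      rw [hpow] at this
      norm_cast at this
      rcases this with h | h
      · exact absurd (by exact_mod_cast h) hy
      · have h' : walshHadamard f y = -2 ^ k := by exact_mod_cast h
        simp only [hy, if_false]
        rw [h', show sgn 1 = -1 from rfl]; ring
  · rintro ⟨g, hg⟩ y
    rw [hpow, hg y]
    rcases sgn_eq_one_or (g y) with h | h <;> rw [h]
    · left; push_cast; ring
    · right; push_cast; ring

lemma sum_walshHadamard_mul_sgn (f : BoolFun n) (x : Fin n → ZMod 2) :
    ∑ y, walshHadamard f y * sgn (y ⬝ᵥ x) = 2 ^ n * sgn (f x) := by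
  simp only [walshHadamard_eq, Finset.sum_mul]
  rw [Finset.sum_comm]
  have : ∀ z, ∑ y, sgn (f z) * sgn (z ⬝ᵥ y) * sgn (y ⬝ᵥ x)
      = if z = x then 2 ^ n * sgn (f z) else 0 := by
    intro z
    have h : ∀ y, sgn (f z) * sgn (z ⬝ᵥ y) * sgn (y ⬝ᵥ x) = sgn (f z) * sgn ((z + x) ⬝ᵥ y) := by
      intro y
      rw [add_dotProduct, sgn_add, dotProduct_comm y x]; ring
    simp only [h]
    rw [← Finset.mul_sum, sum_sgn_dotProduct]
    have hz : z + x = 0 ↔ z = x := by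
      constructor
      · intro h0
        calc z = z + x + x := by rw [add_assoc, add_self_vec, add_zero]
          _ = x := by rw [h0, zero_add]
      · rintro rfl; exact add_self_vec z
    simp only [hz]
    split_ifs <;> ring
  simp only [this]
  simp

lemma IsDual.symm (hn : n = 2 * k) (h : IsDual k f g) : IsDual k g f := by
  intro x
  have h1 := sum_walshHadamard_mul_sgn f x
  simp only [h _, mul_assoc] at h1
  rw [← Finset.mul_sum, ← walshHadamard_eq, show (2 : ℤ) ^ n = 2 ^ k * 2 ^ k by
    rw [← pow_add, ← two_mul, hn], mul_assoc] at h1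
  exact mul_left_cancel₀ (by positivity) h1

lemma IsDual.unique {g' : BoolFun n} (h : IsDual k f g) (h' : IsDual k f g') : g = g' := by
  funext y
  have h1 := (h y).symm.trans (h' y)
  exact sgn_injective (mul_left_cancel₀ (by positivity) h1)

lemma IsDual.unique_left {f' : BoolFun n} (hn : n = 2 * k) (h : IsDual k f g)
    (h' : IsDual k f' g) : f = f' :=
  (h.symm hn).unique (h'.symm hn)

lemma walshHadamard_translate (f : BoolFun n) (z y : Fin n → ZMod 2) :
    walshHadamard (fun x => f (z + x)) y = sgn (z ⬝ᵥ y) * walshHadamard f y := by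
  simp only [walshHadamard_eq]
  rw [← Equiv.sum_comp (Equiv.addLeft z) (fun x => sgn (f x) * sgn (x ⬝ᵥ y)), Finset.mul_sum]
  refine Finset.sum_congr rfl fun x _ => ?_
  rw [Equiv.coe_addLeft, add_dotProduct, sgn_add]
  linear_combination (-sgn (f (z + x)) * sgn (x ⬝ᵥ y)) * sgn_mul_self (z ⬝ᵥ y)

lemma IsDual.translate (h : IsDual k f g) (z : Fin n → ZMod 2) :
    IsDual k (fun x => f (z + x)) (fun y => z ⬝ᵥ y + g y) := by
  intro y
  rw [walshHadamard_translate, h y, sgn_add]; ring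

lemma IsDual.autocorrelation (hn : n = 2 * k) (h : IsDual k f g) {a : Fin n → ZMod 2}
    (ha : a ≠ 0) : ∑ x, sgn (g x) * sgn (g (x + a)) = 0 := by
  have h1 : ∀ x, 2 ^ k * sgn (g x) = ∑ y, sgn (f y) * sgn (y ⬝ᵥ x) := fun x => by
    rw [← h x, walshHadamard_eq]
  have h2 : (2 ^ k * 2 ^ k : ℤ) * ∑ x, sgn (g x) * sgn (g (x + a)) = 0 := by
    calc (2 ^ k * 2 ^ k : ℤ) * ∑ x, sgn (g x) * sgn (g (x + a))
        = 2 ^ k * ∑ x, (∑ y, sgn (f y) * sgn (y ⬝ᵥ x)) * sgn (g (x + a)) := by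
          simp only [← h1, Finset.mul_sum]
          exact Finset.sum_congr rfl fun _ _ => by ring
      _ = 2 ^ k * ∑ y, sgn (f y) * ∑ x, sgn (g x) * sgn (y ⬝ᵥ (x + a)) := by
          congr 1
          simp only [Finset.sum_mul, Finset.mul_sum]
          rw [Finset.sum_comm]
          refine Finset.sum_congr rfl fun y _ => ?_
          rw [← Equiv.sum_comp (Equiv.addRight a)
            (fun x => sgn (f y) * (sgn (g x) * sgn (y ⬝ᵥ (x + a))))]
          refine Finset.sum_congr rfl fun x _ => ?_
          rw [Equiv.coe_addRight, add_assoc, add_self_vec, add_zero]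
          ring
      _ = 2 ^ k * ∑ y, sgn (y ⬝ᵥ a) * (sgn (f y) * walshHadamard g y) := by
          congr 1
          refine Finset.sum_congr rfl fun y _ => ?_
          rw [walshHadamard_eq, Finset.mul_sum, Finset.mul_sum, Finset.mul_sum]
          refine Finset.sum_congr rfl fun x _ => ?_
          rw [dotProduct_add, sgn_add, dotProduct_comm x y]; ring
      _ = 2 ^ k * 2 ^ k * ∑ y, sgn (a ⬝ᵥ y) := by
          rw [mul_assoc, Finset.mul_sum (a := (2 ^ k : ℤ)) (f := fun y => sgn (a ⬝ᵥ y))]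
          congr 1
          refine Finset.sum_congr rfl fun y _ => ?_
          rw [h.symm hn y, dotProduct_comm a y]
          linear_combination (sgn (y ⬝ᵥ a) * 2 ^ k) * sgn_mul_self (f y)
      _ = 0 := by rw [sum_sgn_dotProduct, if_neg ha, mul_zero]
  exact (mul_eq_zero.1 h2).resolve_left (by positivity)

lemma even_sum_sgn {ι : Type*} (s : Finset ι) (hs : Even s.card) (c : ι → ZMod 2) :
    Even (∑ i ∈ s, sgn (c i)) := by
  simp only [sgn_eq_sub, Finset.sum_sub_distrib, ← Finset.mul_sum]
  refine Even.sub ?_ (even_two_mul _)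
  simpa using hs

lemma sum_eq_zero_of_four_dvd {ι : Type*} (s : Finset ι) (hs : 4 ∣ s.card) (c : ι → ZMod 2)
    (h : 4 ∣ ∑ i ∈ s, sgn (c i)) : ∑ i ∈ s, c i = 0 := by
  simp only [sgn_eq_sub, Finset.sum_sub_distrib, ← Finset.mul_sum] at h
  have h1 : (2 : ℕ) ∣ ∑ i ∈ s, (c i).val := by
    have hc : (4 : ℤ) ∣ s.card := by exact_mod_cast hs
    simp only [Finset.sum_const, nsmul_eq_mul, mul_one] at h
    zify
    omega
  have h2 : ((∑ i ∈ s, (c i).val : ℕ) : ZMod 2) = 0 := (ZMod.natCast_eq_zero_iff _ _).2 h1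
  rw [← h2]
  push_cast
  exact Finset.sum_congr rfl fun i _ => (ZMod.natCast_zmod_val _).symm

/-- A bent function has algebraic degree at most half the number of variables. -/
lemma IsDual.sum_coordSubspace_eq_zero (hn : n = 2 * k) (hk : 2 ≤ k) (h : IsDual k f g)
    (z : Fin n → ZMod 2) {T : Finset (Fin n)} (hT : k < T.card) :
    ∑ x ∈ coordSubspace T, f (z + x) = 0 := by
  have four_dvd : ∀ m, 2 ≤ m → (4 : ℤ) ∣ 2 ^ m := fun m hm => pow_dvd_pow 2 hm
  refine sum_eq_zero_of_four_dvd _ ?_ _ ?_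
  · rw [card_coordSubspace]; exact pow_dvd_pow 2 (by omega : 2 ≤ T.card)
  have hp := sum_walshHadamard_coordSubspace (fun x => f (z + x)) T 0
  simp only [dotProduct_zero, sgn_zero, mul_one, zero_add] at hp
  have hc : T.card + Tᶜ.card = n := by rw [Finset.card_add_card_compl, Fintype.card_fin]
  simp only [h.translate z _] at hp
  rw [← Finset.mul_sum] at hp
  set A := ∑ x ∈ coordSubspace T, sgn (f (z + x))
  set B := ∑ v ∈ coordSubspace Tᶜ, sgn (z ⬝ᵥ v + g v)
  have hB : (2 : ℤ) ^ Tᶜ.card * 4 ∣ 2 ^ k * B := by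
    by_cases h0 : Tᶜ.card = 0
    · rw [h0, pow_zero, one_mul]
      exact (four_dvd k hk).mul_right _
    · have : Even B := by
        refine even_sum_sgn _ ?_ _
        rw [card_coordSubspace]
        exact (even_two).pow_of_ne_zero h0
      obtain ⟨b, hb⟩ := this.two_dvd
      rw [hb, ← mul_assoc, ← pow_succ, show (4 : ℤ) = 2 ^ 2 by norm_num, ← pow_add]
      exact (pow_dvd_pow 2 (by omega)).mul_right _
  rw [hp] at hB
  exact (mul_dvd_mul_iff_left (by positivity)).1 hB

/-- The vectors supported in `T` of weight at most `k`. -/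
def lowWeight (k : ℕ) (T : Finset (Fin n)) : Finset (Fin n → ZMod 2) :=
  {x ∈ coordSubspace T | (Finset.univ.filter fun i => x i ≠ 0).card ≤ k}

lemma card_lowWeight (k : ℕ) (T : Finset (Fin n)) :
    (lowWeight k T).card = ∑ i ∈ Finset.range (k + 1), T.card.choose i := by
  classical
  have h1 : (T.powerset.filter fun U => U.card ≤ k).card
      = ∑ i ∈ Finset.range (k + 1), T.card.choose i := by
    rw [Finset.card_eq_sum_card_fiberwise (f := Finset.card) (t := Finset.range (k + 1))
      (fun U hU => by
        have := (Finset.mem_filter.1 hU).2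
        simpa [Nat.lt_succ_iff] using this)]
    refine Finset.sum_congr rfl fun i hi => ?_
    rw [← Finset.card_powersetCard]
    congr 1
    ext U
    simp only [Finset.mem_filter, Finset.mem_powerset, Finset.mem_powersetCard,
      Finset.mem_range] at hi ⊢
    constructor
    · rintro ⟨⟨a, _⟩, c⟩; exact ⟨a, c⟩
    · rintro ⟨a, c⟩; exact ⟨⟨a, by omega⟩, c⟩
  rw [← h1]
  refine Finset.card_nbij' (fun x => Finset.univ.filter fun i => x i ≠ 0)
    (fun U i => if i ∈ U then 1 else 0) ?_ ?_ ?_ ?_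
  · intro x hx
    simp only [lowWeight, Finset.coe_filter, Set.mem_ofPred_eq, mem_coordSubspace,
      Finset.mem_powerset] at hx ⊢
    refine ⟨fun i hi => ?_, hx.2⟩
    by_contra hiT
    exact (Finset.mem_filter.1 hi).2 (hx.1 i hiT)
  · intro U hU
    simp only [lowWeight, Finset.coe_filter, Set.mem_ofPred_eq, mem_coordSubspace,
      Finset.mem_powerset] at hU ⊢
    refine ⟨fun i hi => if_neg fun h => hi (hU.1 h), ?_⟩
    simpa using hU.2
  · intro x _
    ext i
    by_cases hi : x i = 0
    · simp [hi]
    · have : x i = 1 := by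
        revert hi; generalize x i = a; revert a; decide
      simp [this]
  · intro U _
    ext i
    simp

lemma IsDual.eqOn_coordSubspace (hn : n = 2 * k) (hk : 2 ≤ k) {f' g' : BoolFun n}
    (h : IsDual k f g) (h' : IsDual k f' g') (z : Fin n → ZMod 2) {T : Finset (Fin n)}
    (heq : ∀ x ∈ lowWeight k T, f (z + x) = f' (z + x)) :
    ∀ x ∈ coordSubspace T, f (z + x) = f' (z + x) := by
  classical
  have key : ∀ m, ∀ x ∈ coordSubspace T, (Finset.univ.filter fun i => x i ≠ 0).card = m →
      f (z + x) = f' (z + x) := by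
    intro m
    induction m using Nat.strong_induction_on with
    | _ m ih =>
      intro x hx hm
      by_cases hmk : m ≤ k
      · exact heq x (Finset.mem_filter.2 ⟨hx, by rw [hm]; exact hmk⟩)
      set S := Finset.univ.filter fun i => x i ≠ 0 with hS
      have hxS : x ∈ coordSubspace S := mem_coordSubspace.2 fun i hi => by
        simpa [hS] using hi
      have hST : S ⊆ T := fun i hi => by
        by_contra hiT
        exact (Finset.mem_filter.1 hi).2 (mem_coordSubspace.1 hx i hiT)
      have e1 := h.sum_coordSubspace_eq_zero hn hk z (T := S) (by omega)
      have e2 := h'.sum_coordSubspace_eq_zero hn hk z (T := S) (by omega)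
      rw [← Finset.add_sum_erase _ _ hxS] at e1 e2
      have e3 : ∑ u ∈ (coordSubspace S).erase x, f (z + u)
          = ∑ u ∈ (coordSubspace S).erase x, f' (z + u) := by
        refine Finset.sum_congr rfl fun u hu => ?_
        obtain ⟨hux, huS⟩ := Finset.mem_erase.1 hu
        refine ih _ ?_ u (coordSubspace_mono hST huS) rfl
        rw [← hm]
        refine Finset.card_lt_card ⟨fun i hi => ?_, fun hsub => hux ?_⟩
        · by_contra hiS
          exact (Finset.mem_filter.1 hi).2 (mem_coordSubspace.1 huS i hiS)
        · ext i
          by_cases hiS : i ∈ S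
          · have h1 := (Finset.mem_filter.1 hiS).2
            have h2 := (Finset.mem_filter.1 (hsub hiS)).2
            revert h1 h2
            generalize x i = a
            generalize u i = b
            revert a b; decide
          · rw [mem_coordSubspace.1 huS i hiS, mem_coordSubspace.1 hxS i hiS]
      rw [e3] at e1
      exact add_right_cancel (e1.trans e2.symm)
  exact fun x hx => key _ x hx rfl

end Dual

section Transvection

variable {n k : ℕ} {f g : BoolFun n}

/-- The transvection `x ↦ x + ⟨x, c⟩ e_j`. -/
def transvec (j : Fin n) (c x : Fin n → ZMod 2) : Fin n → ZMod 2 :=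
  x + (x ⬝ᵥ c) • Pi.single j 1

/-- The adjoint `y ↦ y + y_j c` of the transvection `x ↦ x + ⟨x, c⟩ e_j`. -/
def transvecAdj (j : Fin n) (c y : Fin n → ZMod 2) : Fin n → ZMod 2 :=
  y + y j • c

lemma transvec_dotProduct (j : Fin n) (c x y : Fin n → ZMod 2) :
    transvec j c x ⬝ᵥ y = x ⬝ᵥ transvecAdj j c y := by
  simp [transvec, transvecAdj, add_dotProduct, dotProduct_add, smul_dotProduct, mul_comm]

lemma transvec_involutive {j : Fin n} {c : Fin n → ZMod 2} (hc : c j = 0) :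
    Function.Involutive (transvec j c) := by
  intro x
  simp [transvec, add_dotProduct, smul_dotProduct, hc, add_assoc, add_self_vec]

lemma transvecAdj_involutive {j : Fin n} {c : Fin n → ZMod 2} (hc : c j = 0) :
    Function.Involutive (transvecAdj j c) := by
  intro y
  simp [transvecAdj, hc, add_assoc, add_self_vec]

lemma transvecAdj_add (j : Fin n) (c x y : Fin n → ZMod 2) :
    transvecAdj j c (x + y) = transvecAdj j c x + transvecAdj j c y := by
  simp only [transvecAdj, Pi.add_apply, add_smul]; abel

lemma IsDual.comp_transvec {j : Fin n} {c : Fin n → ZMod 2} (hc : c j = 0) (h : IsDual k f g) :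
    IsDual k (f ∘ transvec j c) (g ∘ transvecAdj j c) := by
  intro y
  rw [Function.comp_apply, ← h, walshHadamard_eq, walshHadamard_eq,
    ← Equiv.sum_comp (transvec_involutive hc).toPerm]
  refine Finset.sum_congr rfl fun x _ => ?_
  simp only [Function.Involutive.coe_toPerm, Function.comp_apply]
  rw [transvec_involutive hc x, transvec_dotProduct]

lemma sum_coordSubspace_pair {M : Type*} [AddCommMonoid M] {i j : Fin n} (hij : i ≠ j)
    (F : (Fin n → ZMod 2) → M) :
    ∑ v ∈ coordSubspace {i, j}, F v =
      F 0 + F (Pi.single i 1) + F (Pi.single j 1) + F (Pi.single i 1 + Pi.single j 1) := by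
  have e : ∀ u v : Fin n → ZMod 2, (u i ≠ v i ∨ u j ≠ v j) → u ≠ v := by
    rintro u v h rfl; simp at h
  have h1 : (0 : Fin n → ZMod 2) ∉ ({Pi.single i 1, Pi.single j 1,
      Pi.single i 1 + Pi.single j 1} : Finset (Fin n → ZMod 2)) := by
    simp only [Finset.mem_insert, Finset.mem_singleton, not_or]
    refine ⟨e _ _ ?_, e _ _ ?_, e _ _ ?_⟩ <;> simp [hij, hij.symm]
  have h2 : (Pi.single i 1 : Fin n → ZMod 2) ∉ ({Pi.single j 1,
      Pi.single i 1 + Pi.single j 1} : Finset (Fin n → ZMod 2)) := by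
    simp only [Finset.mem_insert, Finset.mem_singleton, not_or]
    refine ⟨e _ _ ?_, e _ _ ?_⟩ <;> simp [hij, hij.symm]
  have h3 : (Pi.single j 1 : Fin n → ZMod 2) ∉
      ({Pi.single i 1 + Pi.single j 1} : Finset (Fin n → ZMod 2)) := by
    simp only [Finset.mem_singleton]
    refine e _ _ ?_; simp [hij]
  have hset : coordSubspace {i, j} = ({0, Pi.single i 1, Pi.single j 1,
      Pi.single i 1 + Pi.single j 1} : Finset (Fin n → ZMod 2)) := by
    symm
    refine Finset.eq_of_subset_of_card_le ?_ ?_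
    · intro v hv
      rw [mem_coordSubspace]
      intro l hl
      simp only [Finset.mem_insert, Finset.mem_singleton, not_or] at hl hv
      rcases hv with rfl | rfl | rfl | rfl <;> simp [hl.1, hl.2]
    · rw [card_coordSubspace, Finset.card_pair hij, Finset.card_insert_of_notMem h1,
        Finset.card_insert_of_notMem h2, Finset.card_insert_of_notMem h3, Finset.card_singleton]
      norm_num
  rw [hset, Finset.sum_insert h1, Finset.sum_insert h2, Finset.sum_insert h3,
    Finset.sum_singleton]
  simp only [add_assoc]

/-- Some second derivative of the dual function in a given direction `a` is nearly balanced. -/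
lemma IsDual.exists_second_derivative (hn : n = 2 * k) (hk : 1 ≤ k) (h : IsDual k f g)
    {a : Fin n → ZMod 2} (ha : a ≠ 0) :
    ∃ b, b ≠ 0 ∧ b ≠ a ∧
      -4 ≤ ∑ x, sgn (g x + g (x + a) + g (x + b) + g (x + (a + b))) := by
  classical
  set u : (Fin n → ZMod 2) → ℤ := fun x => sgn (g x) * sgn (g (x + a)) with hu
  have hu0 : ∑ x, u x = 0 := h.autocorrelation hn ha
  have hC : ∀ b, ∑ x, sgn (g x + g (x + a) + g (x + b) + g (x + (a + b)))
      = ∑ x, u x * u (x + b) := by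
    intro b
    refine Finset.sum_congr rfl fun x _ => ?_
    rw [sgn_add, sgn_add, sgn_add, hu, show x + (a + b) = x + b + a by abel]
    ring
  have hsum : ∑ b, ∑ x, u x * u (x + b) = 0 := by
    rw [Finset.sum_comm]
    refine Finset.sum_eq_zero fun x _ => ?_
    rw [← Finset.mul_sum]
    have := Equiv.sum_comp (Equiv.addLeft x) u
    simp only [Equiv.coe_addLeft] at this
    rw [this, hu0, mul_zero]
  have huu : ∀ x, u x * u x = 1 := fun x => by
    simp only [hu]
    linear_combination sgn_mul_self (g x) * sgn (g (x + a)) * sgn (g (x + a))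
      + sgn_mul_self (g (x + a))
  have hcard : (Fintype.card (Fin n → ZMod 2) : ℤ) = 2 ^ n := by
    simp [ZMod.card]
  have h0 : ∑ x, u x * u (x + 0) = 2 ^ n := by
    simp only [add_zero, huu, Finset.sum_const, Finset.card_univ, nsmul_eq_mul, mul_one, hcard]
  have h1 : ∑ x, u x * u (x + a) = 2 ^ n := by
    rw [← h0]
    refine Finset.sum_congr rfl fun x _ => ?_
    simp only [hu, add_zero, add_assoc, add_self_vec]
    ring
  by_contra! hcon
  rw [← Finset.add_sum_erase _ _ (Finset.mem_univ (0 : Fin n → ZMod 2)),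
    ← Finset.add_sum_erase _ _ (Finset.mem_erase.2 ⟨ha, Finset.mem_univ a⟩), h0, h1] at hsum
  have hle : ∑ b ∈ (Finset.univ.erase (0 : Fin n → ZMod 2)).erase a, ∑ x, u x * u (x + b)
      ≤ ∑ b ∈ (Finset.univ.erase (0 : Fin n → ZMod 2)).erase a, (-5 : ℤ) := by
    refine Finset.sum_le_sum fun b hb => ?_
    simp only [Finset.mem_erase] at hb
    have := hcon b hb.2.1 hb.1
    rw [hC] at this
    omega
  have hcard2 : (((Finset.univ.erase (0 : Fin n → ZMod 2)).erase a).card : ℤ) = 2 ^ n - 2 := by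
    rw [Finset.card_erase_of_mem (Finset.mem_erase.2 ⟨ha, Finset.mem_univ a⟩),
      Finset.card_erase_of_mem (Finset.mem_univ _), Finset.card_univ]
    have : 2 ≤ Fintype.card (Fin n → ZMod 2) := by
      zify; rw [hcard]
      exact le_self_pow₀ (by norm_num) (by omega)
    omega
  rw [Finset.sum_const, nsmul_eq_mul, hcard2] at hle
  have : (2 : ℤ) ^ 2 ≤ 2 ^ n := pow_le_pow_right₀ (by norm_num) (by omega)
  linarith

/-- `f` is bent and the second derivative of its dual along `e_i`, `e_j` is nearly balanced. -/
def IsNearlyBalanced (k : ℕ) (i j : Fin n) (f : BoolFun n) : Prop :=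
  ∃ g : BoolFun n, IsDual k f g ∧
    2 * (Finset.univ.filter fun y => ∑ v ∈ coordSubspace {i, j}, g (y + v) = 1).card ≤ 2 ^ n + 4

lemma IsDual.exists_isNearlyBalanced (hn : n = 2 * k) (hk : 1 ≤ k) (h : IsDual k f g)
    (i : Fin n) :
    ∃ j c, i ≠ j ∧ c j = 0 ∧ IsNearlyBalanced k i j (f ∘ transvec j c) := by
  classical
  obtain ⟨b, hb0, hba, hb⟩ := h.exists_second_derivative hn hk
    (a := Pi.single i 1) (by simp)
  have hj : ∃ j, i ≠ j ∧ b j = 1 := by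
    by_contra! hcon
    have hz : ∀ j, i ≠ j → b j = 0 := fun j hj => by
      have := hcon j hj
      revert this; generalize b j = t; revert t; decide
    by_cases hbi : b i = 0
    · refine hb0 (funext fun j => ?_)
      by_cases hij : i = j
      · subst hij; exact hbi
      · exact hz j hij
    · have hbi1 : b i = 1 := by
        revert hbi; generalize b i = t; revert t; decide
      refine hba (funext fun j => ?_)
      by_cases hij : i = j
      · subst hij; simp [hbi1]
      · rw [hz j hij]; simp [Ne.symm hij]
  obtain ⟨j, hij, hbj⟩ := hj
  have hc : (b + Pi.single j 1 : Fin n → ZMod 2) j = 0 := by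
    rw [Pi.add_apply, Pi.single_eq_same, hbj]; decide
  refine ⟨j, b + Pi.single j 1, hij, hc, _, h.comp_transvec hc, ?_⟩
  set B := transvecAdj j (b + Pi.single j 1) with hB
  have hBi : B (Pi.single i 1) = Pi.single i 1 := by
    simp [hB, transvecAdj, hij.symm]
  have hBj : B (Pi.single j 1) = b := by
    simp only [hB, transvecAdj, Pi.single_eq_same, one_smul]
    rw [add_comm b, ← add_assoc, add_self_vec, zero_add]
  have hB0 : B 0 = 0 := by simp [hB, transvecAdj]
  have hD : ∀ y, ∑ v ∈ coordSubspace {i, j}, (g ∘ B) (y + v) =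
      g (B y) + g (B y + Pi.single i 1) + g (B y + b) + g (B y + (Pi.single i 1 + b)) := by
    intro y
    rw [sum_coordSubspace_pair hij fun v => (g ∘ B) (y + v)]
    simp only [Function.comp_apply, hB, transvecAdj_add]
    simp only [← hB, hBi, hBj, hB0, add_zero]
  simp only [hD]
  set D : (Fin n → ZMod 2) → ZMod 2 := fun x =>
    g x + g (x + Pi.single i 1) + g (x + b) + g (x + (Pi.single i 1 + b)) with hDdef
  have hcB : (Finset.univ.filter fun y => D (B y) = 1).card
      = (Finset.univ.filter fun y => D y = 1).card := by
    have hBB : ∀ y, B (B y) = y := transvecAdj_involutive hc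
    refine Finset.card_nbij' B B ?_ ?_ (fun y _ => hBB y) (fun y _ => hBB y)
    · intro y hy; simpa using hy
    · intro y hy
      simpa [hBB] using hy
  change 2 * (Finset.univ.filter fun y => D (B y) = 1).card ≤ _
  rw [hcB]
  have hs : ∑ x, sgn (D x) = 2 ^ n - 2 * ((Finset.univ.filter fun y => D y = 1).card : ℤ) := by
    simp only [sgn_eq_sub, Finset.sum_sub_distrib, ← Finset.mul_sum, Finset.card_filter]
    have : ∀ x, ((D x).val : ℤ) = ((if D x = 1 then 1 else 0 : ℕ) : ℤ) := by
      intro x; generalize D x = t; revert t; decide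
    simp only [this]
    simp [ZMod.card]
  change -4 ≤ ∑ x, sgn (D x) at hb
  rw [hs] at hb
  zify
  linarith

end Transvection

/-- An upper bound for the number of ways to write `s` as an ordered sum of four signs. -/
def signPatterns (s : ℤ) : ℕ := if s = 0 then 6 else if s ^ 2 = 4 then 4 else 1

lemma card_filter_sum_sgn_le {α : Type*} [Fintype α] [DecidableEq α] (hα : Fintype.card α = 4)
    (s : ℤ) :
    (Finset.univ.filter fun t : α → ZMod 2 => ∑ v, sgn (t v) = s).card ≤ signPatterns s := by
  let e := Fintype.equivFinOfCardEq hα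
  have h1 : (Finset.univ.filter fun t : α → ZMod 2 => ∑ v, sgn (t v) = s).card
      = (Finset.univ.filter fun t : Fin 4 → ZMod 2 => ∑ v, sgn (t v) = s).card := by
    refine Finset.card_equiv (Equiv.arrowCongr e (Equiv.refl _)) fun t => ?_
    simp only [Finset.mem_filter, Finset.mem_univ, true_and, Equiv.arrowCongr_apply,
      Function.comp_apply, Equiv.refl_apply]
    rw [Equiv.sum_comp e.symm fun v => sgn (t v)]
  rw [h1]
  by_cases hs : ∃ t : Fin 4 → ZMod 2, ∑ v, sgn (t v) = s
  · obtain ⟨t, rfl⟩ := hs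
    clear h1
    revert t; decide
  · push Not at hs
    rw [Finset.filter_false_of_mem fun t _ => hs t]
    exact Nat.zero_le _

lemma sum_sgn_four {α : Type*} [Fintype α] (hα : Fintype.card α = 4) (t : α → ZMod 2) :
    (∑ v, sgn (t v) = 0 ∧ ∑ v, t v = 0) ∨ ((∑ v, sgn (t v)) ^ 2 = 4 ∧ ∑ v, t v = 1) ∨
      ((∑ v, sgn (t v)) ^ 2 = 16 ∧ ∑ v, t v = 0) := by
  let e := Fintype.equivFinOfCardEq hα
  rw [← Equiv.sum_comp e.symm, ← Equiv.sum_comp e.symm t]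
  have : ∀ t : Fin 4 → ZMod 2, (∑ v, sgn (t v) = 0 ∧ ∑ v, t v = 0) ∨
      ((∑ v, sgn (t v)) ^ 2 = 4 ∧ ∑ v, t v = 1) ∨
      ((∑ v, sgn (t v)) ^ 2 = 16 ∧ ∑ v, t v = 0) := by decide
  exact this fun v => t (e.symm v)

lemma four_pow_mul_six_pow_le {q₀ q₁ q₄ r : ℕ} (h1 : q₀ + q₁ + q₄ = 8 * r)
    (h2 : q₁ + 4 * q₄ = 8 * r) (h3 : q₁ ≤ 4 * r) :
    4 ^ q₁ * 6 ^ q₀ ≤ 2 ^ (8 * r) * 6 ^ (3 * r) := by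
  obtain ⟨p, rfl⟩ : ∃ p, q₁ = 4 * p := ⟨2 * r - q₄, by omega⟩
  obtain ⟨d, rfl⟩ : ∃ d, r = p + d := ⟨r - p, by omega⟩
  obtain rfl : q₀ = 3 * p + 6 * d := by omega
  calc 4 ^ (4 * p) * 6 ^ (3 * p + 6 * d)
      = 256 ^ p * 6 ^ (3 * p) * 6 ^ (3 * d) * 216 ^ d := by
        rw [show 3 * p + 6 * d = 3 * p + 3 * d + 3 * d by ring, pow_add, pow_add, pow_mul 4,
          pow_mul 6 3 d]
        norm_num; ring
    _ ≤ 256 ^ p * 6 ^ (3 * p) * 6 ^ (3 * d) * 256 ^ d := by gcongr; norm_num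
    _ = 2 ^ (8 * (p + d)) * 6 ^ (3 * (p + d)) := by
        rw [pow_mul 2, mul_add, pow_add 6, pow_add _ p d]
        norm_num; ring

section Fiber

variable {n k : ℕ} {f g : BoolFun n}

/-- The sum of the signs of `g` over a coset of the subspace spanned by `e_i`, `e_j`. -/
def cosetSum (i j : Fin n) (g : BoolFun n) (y : Fin n → ZMod 2) : ℤ :=
  ∑ v ∈ coordSubspace {i, j}, sgn (g (y + v))

lemma card_coordSubspace_pair {i j : Fin n} (hij : i ≠ j) :
    Fintype.card (coordSubspace {i, j} : Finset (Fin n → ZMod 2)) = 4 := by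
  rw [Fintype.card_coe, card_coordSubspace, Finset.card_pair hij]; norm_num

lemma IsDual.sum_cosetSum_sq (hn : n = 2 * k) (h : IsDual k f g) (i j : Fin n) :
    ∑ y ∈ coordSubspace {i, j}ᶜ, cosetSum i j g y ^ 2 = 2 ^ n := by
  have h1 : ∀ y : Fin n → ZMod 2, cosetSum i j g y ^ 2 = ∑ v ∈ coordSubspace {i, j},
      ∑ u ∈ coordSubspace {i, j}, sgn (g (y + v)) * sgn (g (y + v + u)) := by
    intro y
    rw [sq, cosetSum, Finset.sum_mul]
    refine Finset.sum_congr rfl fun v hv => ?_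
    rw [Finset.mul_sum, ← sum_coordSubspace_add _ hv]
    refine Finset.sum_congr rfl fun u _ => ?_
    rw [add_comm u v, add_assoc]
  simp only [h1]
  have h2 := sum_univ_eq_sum_coordSubspace {i, j}ᶜ fun z => ∑ u ∈ coordSubspace {i, j},
    sgn (g z) * sgn (g (z + u))
  rw [compl_compl] at h2
  rw [← h2, Finset.sum_comm, Finset.sum_eq_single 0]
  · simp [sgn_mul_self, ZMod.card]
  · intro u _ hu
    exact h.autocorrelation hn hu
  · intro h0
    exact absurd zero_mem_coordSubspace h0

lemma card_filter_second_derivative (i j : Fin n) (hij : i ≠ j) (g : BoolFun n) :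
    (Finset.univ.filter fun y => ∑ v ∈ coordSubspace {i, j}, g (y + v) = 1).card =
      4 * ((coordSubspace {i, j}ᶜ).filter
        fun y => ∑ v ∈ coordSubspace {i, j}, g (y + v) = 1).card := by
  have h2 := sum_univ_eq_sum_coordSubspace {i, j}ᶜ fun z =>
    if ∑ v ∈ coordSubspace {i, j}, g (z + v) = 1 then 1 else 0
  rw [compl_compl] at h2
  rw [Finset.card_filter, h2, Finset.card_filter, Finset.mul_sum]
  refine Finset.sum_congr rfl fun y _ => ?_
  have : ∀ u ∈ coordSubspace {i, j}, (if ∑ v ∈ coordSubspace {i, j}, g (y + u + v) = 1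
      then 1 else 0) = if ∑ v ∈ coordSubspace {i, j}, g (y + v) = 1 then 1 else 0 := by
    intro u hu
    rw [← sum_coordSubspace_add (fun v => g (y + v)) hu]
    simp only [add_assoc, add_comm u]
  rw [Finset.sum_congr rfl this, Finset.sum_const, card_coordSubspace, Finset.card_pair hij]
  simp

lemma IsDual.prod_signPatterns_le (hn : n = 2 * k) (hk : 3 ≤ k) (h : IsDual k f g)
    {i j : Fin n} (hij : i ≠ j)
    (hbal : 2 * (Finset.univ.filter
      fun y => ∑ v ∈ coordSubspace {i, j}, g (y + v) = 1).card ≤ 2 ^ n + 4) :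
    ∏ y ∈ coordSubspace {i, j}ᶜ, signPatterns (cosetSum i j g y) ≤
      2 ^ (8 * 2 ^ (n - 5)) * 6 ^ (3 * 2 ^ (n - 5)) := by
  classical
  set E := (coordSubspace {i, j}ᶜ : Finset (Fin n → ZMod 2))
  set σ := cosetSum i j g
  set D : (Fin n → ZMod 2) → ZMod 2 := fun y => ∑ v ∈ coordSubspace {i, j}, g (y + v)
  have tri : ∀ y, (σ y = 0 ∧ D y = 0) ∨ (σ y ^ 2 = 4 ∧ D y = 1) ∨ (σ y ^ 2 = 16 ∧ D y = 0) := by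
    intro y
    have := sum_sgn_four (card_coordSubspace_pair hij) fun v => g (y + v.1)
    rwa [Finset.sum_coe_sort (coordSubspace {i, j}) fun v => sgn (g (y + v)),
      Finset.sum_coe_sort (coordSubspace {i, j}) fun v => g (y + v)] at this
  have hr : 2 ^ n = 32 * 2 ^ (n - 5) := by
    rw [show (32 : ℕ) = 2 ^ 5 by norm_num, ← pow_add]; congr 1; omega
  have hr1 : 1 ≤ 2 ^ (n - 5) := Nat.one_le_two_pow
  generalize 2 ^ (n - 5) = r at hr hr1 ⊢
  have hE : E.card = 8 * r := by
    have h1 : ({i, j}ᶜ : Finset (Fin n)).card + 2 = n := by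
      rw [← Finset.card_pair hij, add_comm, Finset.card_add_card_compl, Fintype.card_fin]
    have h2 : E.card * 4 = 2 ^ n := by
      rw [card_coordSubspace, show 4 = 2 ^ 2 by norm_num, ← pow_add, h1]
    omega
  have c1 : (E.filter fun y => σ y = 0).card + (E.filter fun y => D y = 1).card
      + (E.filter fun y => σ y ^ 2 = 16).card = 8 * r := by
    rw [← hE, Finset.card_eq_sum_ones E, Finset.card_filter, Finset.card_filter,
      Finset.card_filter, ← Finset.sum_add_distrib, ← Finset.sum_add_distrib]
    refine Finset.sum_congr rfl fun y _ => ?_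
    rcases tri y with ⟨a, b⟩ | ⟨a, b⟩ | ⟨a, b⟩
    · simp [a, b]
    · have : σ y ≠ 0 := by intro h0; rw [h0] at a; norm_num at a
      simp [a, b, this]
    · have : σ y ≠ 0 := by intro h0; rw [h0] at a; norm_num at a
      simp [a, b, this]
  have c2 : (E.filter fun y => D y = 1).card
      + 4 * (E.filter fun y => σ y ^ 2 = 16).card = 8 * r := by
    have hs := h.sum_cosetSum_sq hn i j
    have hs' : ∑ y ∈ E, σ y ^ 2 = 4 * ((E.filter fun y => D y = 1).card
      + 4 * (E.filter fun y => σ y ^ 2 = 16).card : ℕ) := by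
      rw [Finset.card_filter, Finset.card_filter]
      push_cast
      rw [Finset.mul_sum, ← Finset.sum_add_distrib, Finset.mul_sum]
      refine Finset.sum_congr rfl fun y _ => ?_
      rcases tri y with ⟨a, b⟩ | ⟨a, b⟩ | ⟨a, b⟩ <;> simp [a, b]
    have : (2 : ℤ) ^ n = 32 * r := by exact_mod_cast hr
    have h3 := hs'.symm.trans hs
    rw [this] at h3
    omega
  have c3 : (E.filter fun y => D y = 1).card ≤ 4 * r := by
    rw [card_filter_second_derivative i j hij g] at hbal
    change 2 * (4 * (E.filter fun y => D y = 1).card) ≤ _ at hbal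
    omega
  refine le_trans (le_of_eq ?_) (four_pow_mul_six_pow_le c1 c2 c3)
  rw [← Finset.prod_const, ← Finset.prod_const, Finset.prod_filter, Finset.prod_filter,
    ← Finset.prod_mul_distrib]
  refine Finset.prod_congr rfl fun y _ => ?_
  rw [signPatterns]
  rcases tri y with ⟨a, b⟩ | ⟨a, b⟩ | ⟨a, b⟩
  · simp [a, b]
  · have : σ y ≠ 0 := by intro h0; rw [h0] at a; norm_num at a
    simp [a, b, this]
  · have : σ y ≠ 0 := by intro h0; rw [h0] at a; norm_num at a
    simp [a, b, this]

lemma IsDual.cosetSum_eq (h : IsDual k f g) {f' g' : BoolFun n} (h' : IsDual k f' g')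
    {i j : Fin n} (heq : ∀ x ∈ coordSubspace {i, j}ᶜ, f x = f' x) (y : Fin n → ZMod 2) :
    cosetSum i j g y = cosetSum i j g' y := by
  have key : ∀ f g : BoolFun n, IsDual k f g → 2 ^ k * cosetSum i j g y =
      2 ^ ({i, j} : Finset (Fin n)).card *
        ∑ x ∈ coordSubspace {i, j}ᶜ, sgn (f x) * sgn (x ⬝ᵥ y) := by
    intro f g h
    have := sum_walshHadamard_coordSubspace f {i, j}ᶜ y
    rw [compl_compl] at this
    rw [← this, cosetSum, Finset.mul_sum]
    exact Finset.sum_congr rfl fun v _ => (h _).symm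
  refine mul_left_cancel₀ (pow_ne_zero k two_ne_zero) ((key f g h).trans (Eq.trans ?_
    (key f' g' h').symm))
  congr 1
  exact Finset.sum_congr rfl fun x hx => by rw [heq x hx]

open Classical in
/-- The number of nearly balanced bent functions with prescribed values on the low weight vectors
of a coordinate subspace of codimension two. -/
lemma card_fiber_pow_le (hn : n = 2 * k) (hk : 3 ≤ k) {i j : Fin n} (hij : i ≠ j)
    (φ : BoolFun n) :
    (Finset.univ.filter fun f : BoolFun n => IsNearlyBalanced k i j f ∧
      ∀ x ∈ lowWeight k {i, j}ᶜ, f x = φ x).card ^ (8 * 2 ^ (n - 5)) ≤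
      (2 ^ (8 * 2 ^ (n - 5)) * 6 ^ (3 * 2 ^ (n - 5))) ^
        (lowWeight k ({i, j}ᶜ : Finset (Fin n))).card := by
  set F := Finset.univ.filter fun f : BoolFun n => IsNearlyBalanced k i j f ∧
      ∀ x ∈ lowWeight k {i, j}ᶜ, f x = φ x
  set T := ({i, j}ᶜ : Finset (Fin n)) with hT
  rcases F.eq_empty_or_nonempty with h0 | ⟨f₀, hf₀⟩
  · rw [h0, Finset.card_empty, zero_pow (by positivity)]
    exact Nat.zero_le _
  have hF : ∀ f ∈ F, IsNearlyBalanced k i j f ∧ ∀ x ∈ lowWeight k T, f x = φ x :=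
    fun f hf => (Finset.mem_filter.1 hf).2
  obtain ⟨⟨g₀, hd₀, hbal⟩, hφ₀⟩ := hF f₀ hf₀
  have hdual : ∀ f : BoolFun n, ∃ g, f ∈ F → IsDual k f g := fun f => by
    by_cases hf : f ∈ F
    · obtain ⟨⟨g, hg, _⟩, _⟩ := hF f hf
      exact ⟨g, fun _ => hg⟩
    · exact ⟨f, fun h => absurd h hf⟩
  choose G hG using hdual
  have hσ : ∀ f ∈ F, ∀ y, cosetSum i j (G f) y = cosetSum i j g₀ y := by
    intro f hf y
    refine (hG f hf).cosetSum_eq hd₀ ?_ y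
    have := (hG f hf).eqOn_coordSubspace hn (by omega) hd₀ 0 (T := T) fun x hx => by
      rw [zero_add, (hF f hf).2 x hx, hφ₀ x hx]
    simpa only [zero_add] using this
  have hw : ∀ w ∈ coordSubspace T,
      F.card ≤ ∏ x ∈ lowWeight k T, signPatterns (cosetSum i j g₀ (x + w)) := by
    intro w _
    let A : (Fin n → ZMod 2) → Finset (↥(coordSubspace ({i, j} : Finset (Fin n))) → ZMod 2) :=
      fun y => Finset.univ.filter fun t => ∑ v, sgn (t v) = cosetSum i j g₀ y
    calc F.card ≤ (Fintype.piFinset fun x : ↥(lowWeight k T) => A (x.1 + w)).card := by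
          refine Finset.card_le_card_of_injOn (fun f x v => G f (x.1 + w + v.1)) ?_ ?_
          · intro f hf
            simp only [Finset.mem_coe, Fintype.mem_piFinset]
            intro x
            refine Finset.mem_filter.2 ⟨Finset.mem_univ _, ?_⟩
            rw [← hσ f hf]
            exact Finset.sum_coe_sort (coordSubspace {i, j}) fun v => sgn (G f (x.1 + w + v))
          · intro f hf f' hf' hff
            have hd := hG f hf
            have hd' := hG f' hf'
            have hgg : G f = G f' := by
              have hv : ∀ v ∈ coordSubspace ({i, j} : Finset (Fin n)), ∀ x ∈ coordSubspace T,
                  G f (w + v + x) = G f' (w + v + x) := by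
                intro v hv
                refine (hd.symm hn).eqOn_coordSubspace hn (by omega) (hd'.symm hn) (w + v) ?_
                intro x hx
                have := congrFun (congrFun hff ⟨x, hx⟩) ⟨v, hv⟩
                simp only at this
                rwa [show w + v + x = x + w + v by abel]
              funext z
              have hz : z = w + (fun l => if l ∈ T then 0 else (z + w) l)
                  + (fun l => if l ∈ T then (z + w) l else 0) := by
                ext l
                have : w l + (z l + w l) = z l := by
                  generalize z l = a
                  generalize w l = b
                  revert a b; decide
                by_cases hl : l ∈ T <;> simp [hl, this]
              rw [hz]
              refine hv _ ?_ _ ?_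
              · refine mem_coordSubspace.2 fun l hl => if_pos ?_
                rw [hT, Finset.mem_compl]; exact hl
              · exact mem_coordSubspace.2 fun l hl => if_neg hl
            rw [← hgg] at hd'
            exact hd.unique_left hn hd'
      _ = ∏ x ∈ lowWeight k T, (A (x + w)).card := by
          rw [Fintype.card_piFinset, Finset.prod_coe_sort (lowWeight k T) fun x => (A (x + w)).card]
      _ ≤ _ := Finset.prod_le_prod' fun x _ =>
          card_filter_sum_sgn_le (card_coordSubspace_pair hij) _
  have hE : (coordSubspace T).card = 8 * 2 ^ (n - 5) := by
    have h1 : T.card + 2 = n := by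
      rw [← Finset.card_pair hij, add_comm, Finset.card_add_card_compl, Fintype.card_fin]
    rw [card_coordSubspace, show (8 : ℕ) = 2 ^ 3 by norm_num, ← pow_add]
    congr 1
    omega
  calc F.card ^ (8 * 2 ^ (n - 5)) = ∏ w ∈ coordSubspace T, F.card := by
        rw [Finset.prod_const, hE]
    _ ≤ ∏ w ∈ coordSubspace T, ∏ x ∈ lowWeight k T, signPatterns (cosetSum i j g₀ (x + w)) :=
        Finset.prod_le_prod' hw
    _ = ∏ x ∈ lowWeight k T, ∏ y ∈ coordSubspace T, signPatterns (cosetSum i j g₀ y) := by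
        rw [Finset.prod_comm]
        refine Finset.prod_congr rfl fun x hx => ?_
        rw [← prod_coordSubspace_add (fun y => signPatterns (cosetSum i j g₀ y))
          (Finset.mem_filter.1 hx).1]
        simp only [add_comm x]
    _ = (∏ y ∈ coordSubspace T, signPatterns (cosetSum i j g₀ y)) ^ (lowWeight k T).card := by
        rw [Finset.prod_const]
    _ ≤ _ := Nat.pow_le_pow_left (hd₀.prod_signPatterns_le hn hk hij hbal) _

end Fiber

lemma two_mul_sum_range_choose_le (m : ℕ) :
    2 * ∑ i ∈ Finset.range (m + 2), (2 * m).choose i ≤ 4 ^ m + 3 * m.centralBinom := by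
  have h1 := Nat.sum_range_choose_halfway m
  rw [Finset.sum_range_succ'] at h1
  simp only [Nat.choose_succ_succ', Finset.sum_add_distrib] at h1
  have h2 : ∑ i ∈ Finset.range (m + 1), (2 * m).choose i
      = ∑ i ∈ Finset.range m, (2 * m).choose i + m.centralBinom := by
    rw [Finset.sum_range_succ, Nat.centralBinom]
  have h3 := Finset.sum_range_succ' (fun i => (2 * m).choose i) m
  have h4 : (2 * m).choose (m + 1) ≤ m.centralBinom := Nat.choose_le_centralBinom _ _
  rw [Finset.sum_range_succ]
  simp only [Nat.choose_zero_right] at h1 h3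
  omega

lemma centralBinom_sq_mul_le (m : ℕ) : m.centralBinom ^ 2 * (2 * m + 1) ≤ 16 ^ m := by
  induction m with
  | zero => simp
  | succ m ih =>
    have h := Nat.succ_mul_centralBinom_succ m
    refine Nat.le_of_mul_le_mul_left ?_ (by positivity : 0 < (m + 1) ^ 2)
    calc (m + 1) ^ 2 * ((m + 1).centralBinom ^ 2 * (2 * (m + 1) + 1))
        = ((m + 1) * (m + 1).centralBinom) ^ 2 * (2 * m + 3) := by ring
      _ = m.centralBinom ^ 2 * (2 * m + 1) * (4 * ((2 * m + 1) * (2 * m + 3))) := by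
          rw [h]; ring
      _ ≤ 16 ^ m * (4 * ((2 * m + 1) * (2 * m + 3))) := Nat.mul_le_mul_right _ ih
      _ ≤ 16 ^ m * (16 * (m + 1) ^ 2) := Nat.mul_le_mul_left _ (by nlinarith)
      _ = (m + 1) ^ 2 * 16 ^ (m + 1) := by ring

lemma centralBinom_le_div_sqrt (m : ℕ) :
    (m.centralBinom : ℝ) ≤ 4 ^ m / √(2 * m + 1) := by
  have h : ((m.centralBinom : ℝ)) ^ 2 * (2 * m + 1) ≤ 16 ^ m := by
    exact_mod_cast centralBinom_sq_mul_le m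
  rw [le_div_iff₀ (by positivity)]
  refine le_of_pow_le_pow_left₀ two_ne_zero (by positivity) ?_
  rw [mul_pow, Real.sq_sqrt (by positivity), ← pow_mul, mul_comm m 2, pow_mul]
  norm_num
  exact h

section Count

variable {n k : ℕ}

open Classical in
lemma card_isNearlyBalanced_le (hn : n = 2 * k) (hk : 3 ≤ k) {i j : Fin n} (hij : i ≠ j)
    {M : ℕ} (hM : M = ∑ l ∈ Finset.range (k + 1), (n - 2).choose l) :
    ((Finset.univ.filter fun f : BoolFun n => IsNearlyBalanced k i j f).card : ℝ) ≤
      4 ^ M * (6 : ℝ) ^ (3 * (M : ℝ) / 8) := by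
  set T := ({i, j}ᶜ : Finset (Fin n)) with hT
  have hTc : T.card = n - 2 := by
    rw [hT, Finset.card_compl, Fintype.card_fin, Finset.card_pair hij]
  have hI : (lowWeight k T).card = M := by rw [card_lowWeight, hTc, hM]
  have hfib : ∀ φ : BoolFun n, ((Finset.univ.filter fun f : BoolFun n =>
      IsNearlyBalanced k i j f ∧ ∀ x ∈ lowWeight k T, f x = φ x).card : ℝ)
      ≤ 2 ^ M * (6 : ℝ) ^ (3 * (M : ℝ) / 8) := by
    intro φ
    have h := card_fiber_pow_le hn hk hij φ
    rw [hI] at h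
    have hr : 0 < 2 ^ (n - 5) := by positivity
    generalize 2 ^ (n - 5) = r at h hr
    refine le_of_pow_le_pow_left₀ (n := 8 * r) (by omega) (by positivity) ?_
    calc _ ≤ (((2 ^ (8 * r) * 6 ^ (3 * r)) ^ M : ℕ) : ℝ) := by exact_mod_cast h
      _ = _ := by
        push_cast
        rw [mul_pow, mul_pow, ← pow_mul, ← pow_mul, ← pow_mul, ← Real.rpow_natCast,
          ← Real.rpow_natCast 6, ← Real.rpow_mul_natCast (by norm_num), ← Real.rpow_natCast 2]
        congr 2 <;> push_cast <;> ring
  have hcard := Finset.card_le_mul_card_image_of_maps_to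
    (s := Finset.univ.filter fun f : BoolFun n => IsNearlyBalanced k i j f)
    (t := (Finset.univ : Finset (↥(lowWeight k T) → ZMod 2)))
    (f := fun f x => f x.1) (fun _ _ => Finset.mem_univ _)
    ⌊2 ^ M * (6 : ℝ) ^ (3 * (M : ℝ) / 8)⌋₊ (fun ψ _ => by
      refine Nat.le_floor (le_trans ?_ (hfib fun x => if h : x ∈ lowWeight k T then ψ ⟨x, h⟩ else 0))
      refine Nat.cast_le.2 (Finset.card_le_card fun f hf => ?_)
      simp only [Finset.mem_filter, Finset.mem_univ, true_and] at hf ⊢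
      refine ⟨hf.1, fun x hx => ?_⟩
      rw [dif_pos hx, ← hf.2])
  have huniv : (Finset.univ : Finset (↥(lowWeight k T) → ZMod 2)).card = 2 ^ M := by
    rw [Finset.card_univ, Fintype.card_fun, ZMod.card, Fintype.card_coe, hI]
  rw [huniv] at hcard
  calc _ ≤ ((⌊2 ^ M * (6 : ℝ) ^ (3 * (M : ℝ) / 8)⌋₊ * 2 ^ M : ℕ) : ℝ) := by exact_mod_cast hcard
    _ = (⌊2 ^ M * (6 : ℝ) ^ (3 * (M : ℝ) / 8)⌋₊ : ℝ) * 2 ^ M := by push_cast; rfl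
    _ ≤ 2 ^ M * (6 : ℝ) ^ (3 * (M : ℝ) / 8) * 2 ^ M := by
        gcongr; exact Nat.floor_le (by positivity)
    _ = _ := by rw [show (4 : ℝ) = 2 * 2 by norm_num, mul_pow]; ring

lemma numBent_le (hn : n = 2 * k) (hk : 3 ≤ k) {M : ℕ}
    (hM : M = ∑ l ∈ Finset.range (k + 1), (n - 2).choose l) :
    (numBent n : ℝ) ≤ n * 2 ^ n * (4 ^ M * (6 : ℝ) ^ (3 * (M : ℝ) / 8)) := by
  classical
  let i : Fin n := ⟨0, by omega⟩
  let P : Fin n → Finset (BoolFun n) := fun j =>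
    Finset.univ.filter fun f => IsNearlyBalanced k i j f
  let s : Finset (Fin n × (Fin n → ZMod 2)) :=
    Finset.univ.filter fun p => i ≠ p.1 ∧ p.2 p.1 = 0
  have hsub : (Finset.univ.filter fun f : BoolFun n => IsBent f) ⊆
      s.biUnion fun p => Finset.univ.filter fun f => f ∘ transvec p.1 p.2 ∈ P p.1 := by
    intro f hf
    obtain ⟨g, hg⟩ := (isBent_iff_exists_isDual hn).1 (Finset.mem_filter.1 hf).2
    obtain ⟨j, c, hij, hc, hb⟩ := hg.exists_isNearlyBalanced hn (by omega) i
    simp only [s, P, Finset.mem_biUnion, Finset.mem_filter, Finset.mem_univ, true_and]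
    exact ⟨(j, c), ⟨hij, hc⟩, hb⟩
  have hP : ∀ p ∈ s, (Finset.univ.filter fun f : BoolFun n =>
      f ∘ transvec p.1 p.2 ∈ P p.1).card ≤ ⌊4 ^ M * (6 : ℝ) ^ (3 * (M : ℝ) / 8)⌋₊ := by
    intro p hp
    obtain ⟨hij, hc⟩ := (Finset.mem_filter.1 hp).2
    refine (Finset.card_le_card_of_injOn (t := P p.1) (fun f => f ∘ transvec p.1 p.2) ?_ ?_).trans
      (Nat.le_floor (card_isNearlyBalanced_le hn hk hij hM))
    · intro f hf; exact (Finset.mem_filter.1 hf).2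
    · exact (transvec_involutive hc).surjective.injective_comp_right.injOn
  have hcard := (Finset.card_le_card hsub).trans (Finset.card_biUnion_le_card_mul _ _ _ hP)
  have hs : s.card ≤ n * 2 ^ n := by
    refine (Finset.card_le_univ s).trans (le_of_eq ?_)
    simp [ZMod.card]
  have hN : numBent n = (Finset.univ.filter fun f : BoolFun n => IsBent f).card := by
    rw [numBent, Nat.card_eq_fintype_card, Fintype.card_subtype]
  calc (numBent n : ℝ) ≤ ((n * 2 ^ n * ⌊4 ^ M * (6 : ℝ) ^ (3 * (M : ℝ) / 8)⌋₊ : ℕ) : ℝ) := by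
        rw [hN]; exact_mod_cast hcard.trans (Nat.mul_le_mul_right _ hs)
    _ = n * 2 ^ n * (⌊4 ^ M * (6 : ℝ) ^ (3 * (M : ℝ) / 8)⌋₊ : ℝ) := by push_cast; rfl
    _ ≤ _ := by gcongr; exact Nat.floor_le (by positivity)

lemma numBent_le_two_pow (n : ℕ) : numBent n ≤ 2 ^ 2 ^ n := by
  classical
  rw [numBent, Nat.card_eq_fintype_card]
  refine (Fintype.card_subtype_le _).trans (le_of_eq ?_)
  simp [ZMod.card]

end Count

lemma six_rpow_le {x : ℝ} (hx : 0 ≤ x) : (6 : ℝ) ^ (3 * x) ≤ 2 ^ (8 * x) := by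
  rw [Real.rpow_mul (by norm_num), Real.rpow_mul (by norm_num)]
  exact Real.rpow_le_rpow (by positivity) (by norm_num) hx

lemma six_rpow_lt {x : ℝ} (hx : 0 < x) : (6 : ℝ) ^ (3 * x) < 2 ^ (8 * x) := by
  rw [Real.rpow_mul (by norm_num), Real.rpow_mul (by norm_num)]
  exact Real.rpow_lt_rpow (by positivity) (by norm_num) hx

/-- An explicit error term for the upper bound on the number of bent functions. -/
noncomputable def bentError (n : ℕ) : ℝ :=
  if n < 6 then 4 else 2 * n / 2 ^ (n - 2) + 5 / √(n - 1)

lemma bentError_nonneg (n : ℕ) : 0 ≤ bentError n := by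
  unfold bentError; split_ifs <;> positivity

lemma tendsto_bentError : Tendsto bentError atTop (𝓝 0) := by
  have h1 : Tendsto (fun n : ℕ => 8 * ((n : ℝ) ^ 1 / 2 ^ n) + 5 / √((n : ℝ) - 1)) atTop (𝓝 0) := by
    have a := (tendsto_pow_const_div_const_pow_of_one_lt 1 (by norm_num : (1 : ℝ) < 2)).const_mul 8
    have b : Tendsto (fun n : ℕ => 5 / √((n : ℝ) - 1)) atTop (𝓝 0) :=
      (Real.tendsto_sqrt_atTop.comp
        (tendsto_atTop_add_const_right _ (-1) tendsto_natCast_atTop_atTop)).const_div_atTop 5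
    simpa using a.add b
  refine h1.congr' ?_
  filter_upwards [eventually_ge_atTop 6] with n hn
  rw [bentError, if_neg (by omega)]
  congr 1
  obtain ⟨m, rfl⟩ : ∃ m, n = m + 2 := ⟨n - 2, by omega⟩
  rw [Nat.add_sub_cancel, pow_add]
  field_simp
  ring

lemma two_rpow_natCast_sub (n m : ℕ) : (2 : ℝ) ^ ((n : ℝ) - m) = 2 ^ n / 2 ^ m := by
  rw [Real.rpow_sub (by norm_num), Real.rpow_natCast, Real.rpow_natCast]

lemma numBent_le_bentError {n : ℕ} (hn : Even n) :
    (numBent n : ℝ) ≤ (6 : ℝ) ^ (3 * (2 : ℝ) ^ ((n : ℝ) - 6)) *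
      (2 : ℝ) ^ ((2 : ℝ) ^ ((n : ℝ) - 2) * (1 + bentError n)) := by
  have e6 := two_rpow_natCast_sub n 6
  have e2 := two_rpow_natCast_sub n 2
  norm_num only [Nat.cast_ofNat] at e6 e2
  rw [e6, e2]
  have hpos : (0 : ℝ) < 2 ^ n := by positivity
  by_cases h6 : n < 6
  · rw [bentError, if_pos h6]
    calc (numBent n : ℝ) ≤ ((2 ^ 2 ^ n : ℕ) : ℝ) := Nat.cast_le.2 (numBent_le_two_pow n)
      _ = 1 * (2 : ℝ) ^ ((2 : ℝ) ^ n) := by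
        rw [one_mul]; push_cast
        rw [← Real.rpow_natCast]; push_cast; rfl
      _ ≤ _ := by
        gcongr
        · exact Real.one_le_rpow (by norm_num) (by positivity)
        · norm_num
        · linarith
  · obtain ⟨k, hk⟩ := hn
    have hn2 : n = 2 * k := by omega
    obtain ⟨m, rfl⟩ : ∃ m, k = m + 1 := ⟨k - 1, by omega⟩
    set M := ∑ l ∈ Finset.range (m + 1 + 1), (n - 2).choose l with hM
    have hN := numBent_le hn2 (by omega) hM
    have hsub : n - 2 = 2 * m := by omega
    rw [bentError, if_neg h6]
    set θ := 1 / √((n : ℝ) - 1) with hθ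
    have hθ0 : 0 ≤ θ := by positivity
    have h4 : (4 : ℝ) ^ m = 2 ^ n / 4 := by
      rw [hn2, pow_mul, pow_succ]; norm_num
    set Q : ℝ := 2 ^ n / 4 with hQ
    have hM2 : 2 * (M : ℝ) ≤ Q * (1 + 3 * θ) := by
      have a : 2 * M ≤ 4 ^ m + 3 * m.centralBinom := by
        rw [hM, hsub]; exact two_mul_sum_range_choose_le m
      have b : 2 * (M : ℝ) ≤ 4 ^ m + 3 * m.centralBinom := by exact_mod_cast a
      have c := centralBinom_le_div_sqrt m
      have d : (2 : ℝ) * m + 1 = n - 1 := by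
        rw [hn2]; push_cast; ring
      rw [d, h4, div_eq_mul_one_div] at c
      rw [h4] at b
      linarith
    have hn2n : (n : ℝ) * 2 ^ n ≤ (2 : ℝ) ^ (2 * (n : ℝ)) := by
      have : (n : ℝ) ≤ 2 ^ n := by exact_mod_cast Nat.lt_two_pow_self.le
      rw [two_mul, Real.rpow_add (by norm_num), Real.rpow_natCast]
      gcongr
    have hQpow : (2 : ℝ) ^ (n - 2) = Q := by
      rw [hsub, pow_mul]; norm_num [h4]
    have hQ0 : 0 < Q := by positivity
    calc (numBent n : ℝ) ≤ n * 2 ^ n * (4 ^ M * (6 : ℝ) ^ (3 * (M : ℝ) / 8)) := hN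
      _ ≤ (2 : ℝ) ^ (2 * (n : ℝ)) * ((2 : ℝ) ^ (Q * (1 + 3 * θ)) *
          (6 : ℝ) ^ (3 * Q / 16 + 3 * (3 * Q * θ / 16))) := by
        gcongr
        · rw [show (4 : ℝ) = 2 ^ (2 : ℝ) by norm_num, ← Real.rpow_mul_natCast (by norm_num)]
          exact Real.rpow_le_rpow_of_exponent_le (by norm_num) hM2
        · norm_num
        · linarith
      _ ≤ (2 : ℝ) ^ (2 * (n : ℝ)) * ((2 : ℝ) ^ (Q * (1 + 3 * θ)) *
          ((6 : ℝ) ^ (3 * Q / 16) * 2 ^ (8 * (3 * Q * θ / 16)))) := by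
        rw [Real.rpow_add (by norm_num : (0 : ℝ) < 6)]
        gcongr
        exact six_rpow_le (by positivity)
      _ = (6 : ℝ) ^ (3 * (2 ^ n / 64 : ℝ)) *
          (2 : ℝ) ^ (2 * (n : ℝ) + Q * (1 + 3 * θ) + 8 * (3 * Q * θ / 16)) := by
        rw [Real.rpow_add (by norm_num), Real.rpow_add (by norm_num),
          show 3 * Q / 16 = 3 * (2 ^ n / 64 : ℝ) by rw [hQ]; ring]
        ring
      _ ≤ _ := by
        gcongr
        · norm_num
        · rw [hQpow, show 5 / √((n : ℝ) - 1) = 5 * θ by rw [hθ]; ring]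
          have : Q * (1 + (2 * n / Q + 5 * θ)) = Q + 2 * n + 5 * (Q * θ) := by
            field_simp; ring
          rw [this]
          nlinarith [mul_nonneg hQ0.le hθ0]

theorem mainTheorem1 :
    (∃ ε : ℕ → ℝ, Tendsto ε atTop (𝓝 0) ∧
      ∀ n : ℕ, Even n →
        (numBent n : ℝ) ≤
          (6 : ℝ) ^ (3 * (2 : ℝ) ^ ((n : ℝ) - 6)) *
            (2 : ℝ) ^ ((2 : ℝ) ^ ((n : ℝ) - 2) * (1 + ε n))) ∧
    (∃ δ : ℕ → ℝ, Tendsto δ atTop (𝓝 0) ∧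
      (∀ n : ℕ, Even n →
        Real.logb 2 (numBent n : ℝ) ≤ 3 * (2 : ℝ) ^ ((n : ℝ) - 3) * (1 + δ n)) ∧
      (∀ᶠ n : ℕ in atTop,
        3 * (2 : ℝ) ^ ((n : ℝ) - 3) * (1 + δ n) < (2 : ℝ) ^ ((n : ℝ) - 1))) ∧
    (∀ n : ℕ,
      (6 : ℝ) ^ (3 * (2 : ℝ) ^ ((n : ℝ) - 6)) * (2 : ℝ) ^ ((2 : ℝ) ^ ((n : ℝ) - 2)) <
        (2 : ℝ) ^ (3 * (2 : ℝ) ^ ((n : ℝ) - 3))) := by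
  have e6 := fun n => two_rpow_natCast_sub n 6
  have e3 := fun n => two_rpow_natCast_sub n 3
  have e2 := fun n => two_rpow_natCast_sub n 2
  have e1 := fun n => two_rpow_natCast_sub n 1
  norm_num only [Nat.cast_ofNat, Nat.cast_one] at e6 e3 e2 e1
  refine ⟨⟨bentError, tendsto_bentError, fun n hn => numBent_le_bentError hn⟩,
    ⟨fun n => 2 / 3 * bentError n, ?_, fun n hn => ?_, ?_⟩, fun n => ?_⟩
  · simpa using tendsto_bentError.const_mul (2 / 3)
  · have h := numBent_le_bentError hn
    have h0 := bentError_nonneg n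
    rw [e6, e2] at h
    rw [e3]
    rcases (Nat.cast_nonneg (α := ℝ) (numBent n)).eq_or_lt with hz | hpos
    · rw [← hz, Real.logb_zero]; positivity
    · rw [Real.logb_le_iff_le_rpow (by norm_num) hpos]
      calc (numBent n : ℝ) ≤ _ := h
        _ ≤ (2 : ℝ) ^ (8 * (2 ^ n / 64 : ℝ)) * (2 : ℝ) ^ (2 ^ n / 4 * (1 + bentError n)) := by
          gcongr
          exact six_rpow_le (by positivity)
        _ = _ := by
          rw [← Real.rpow_add (by norm_num)]
          congr 1
          ring
  · filter_upwards [tendsto_bentError.eventually (gt_mem_nhds (by norm_num : (0 : ℝ) < 1 / 2))]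
      with n hn
    rw [e3, e1]
    have : (0 : ℝ) < 2 ^ n := by positivity
    nlinarith
  · rw [e6, e3, e2]
    calc _ < (2 : ℝ) ^ (8 * (2 ^ n / 64 : ℝ)) * (2 : ℝ) ^ (2 ^ n / 4 : ℝ) := by
          gcongr
          exact six_rpow_lt (by positivity)
      _ = _ := by
          rw [← Real.rpow_add (by norm_num)]
          congr 1
          ring
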